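/- Let $n\ge 1$, let $W=S_{n+1}$ be the Weyl group of type $A_n$, acting by permutation of coordinates, and let $S=\{s_1,\dots,s_n\}$, $s_i=(i\ \,i+1)$, be its set of simple reflections. For a dominant weight $\lambda=(\lambda_1\ge\lambda_2\ge\cdots\ge\lambda_{n+1})$ let $P_\lambda=\mathrm{Conv}(W\cdot\lambda)$, and say that $\lambda$ is of type $J\subseteq S$ if $J=\{s\in S : s(\lambda)=\lambda\}$. The projective toric variety $X(J)$ is the one associated with the normal fan of $P_\lambda$ for $\lambda$ of type $J$; the $h$-polynomial of $X(J)$ is $h(t)=\sum_{i=0}^{d} f_i\,(t-1)^i$, where $d=\dim P_\lambda$ and $f_i$ is the number of $i$-dimensional faces of $P_\lambda$. The set $J$ is called combinatorially smooth if $P_\lambda$ is a simple polytope, i.e. each vertex of $P_\lambda$ lies on exactly $d$ edges. (These notions do not depend on the choice of $\lambda$ of type $J$.) For $m\ge 0$ let $E_m(t)=\sum_{i\ge 0}E(m,i)\,t^i$ be the $m$-th Eulerian polynomial, where $E(m,i)$ is the number of permutations $(p_1,\dots,p_m)\in S_m$ with exactly $i$ ascents, that is, exactly $i$ indices $1\le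 j<m$ with $p_j<p_{j+1}$; in particular $E_0=1$. For $0\le k\le n$ let $J(k,n)=\{s_{n-k+1},s_{n-k+2},\dots,s_n\}$ (so $J(0,n)=\emptyset$), and let $h_k(t)$ be the $h$-polynomial of $X(J(k,n))$. Then for every $1\le k\le n$ the set $J(k,n)$ is combinatorially smooth, and $$h_k(t)=h_{k-1}(t)-\binom{n+1}{k+1}\,\bigl(t^k+t^{k-1}+\cdots+t\bigr)\,E_{n-k}(t).$$ -/

import Mathlib

open Polynomial

namespace OrbitPolytope

section Polytopes

variable (𝕜 : Type*) [Field 𝕜] [LinearOrder 𝕜] [IsStrictOrderedRing 𝕜]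
variable {E : Type*} [AddCommGroup E] [Module 𝕜 E]

/-- `F` is a nonempty face of `P`: the set of points of `P` at which some linear functional attains
its maximum over `P`. The functional `0` shows that a nonempty `P` is a face of itself. -/
def IsFace (P F : Set E) : Prop :=
  F.Nonempty ∧ ∃ l : E →ₗ[𝕜] 𝕜, F = {x ∈ P | ∀ y ∈ P, l y ≤ l x}

/-- The (affine) dimension of a nonempty set: the dimension of its direction space. -/
noncomputable def dim (F : Set E) : ℕ := Module.finrank 𝕜 (vectorSpan 𝕜 F)

/-- The number `f_i` of `i`-dimensional faces of `P`. -/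
noncomputable def faceNumber (P : Set E) (i : ℕ) : ℕ :=
  {F : Set E | IsFace 𝕜 P F ∧ dim 𝕜 F = i}.ncard

/-- The `h`-polynomial `h(t) = f(t - 1) = ∑_{i=0}^d f_i (t - 1)^i` of a `d`-dimensional
polytope. -/
noncomputable def hPoly (P : Set E) : ℤ[X] :=
  ∑ i ∈ Finset.range (dim 𝕜 P + 1), C (faceNumber 𝕜 P i : ℤ) * (X - 1) ^ i

/-- A `d`-dimensional polytope is simple if each of its vertices lies on exactly `d` edges. -/
def IsSimple (P : Set E) : Prop :=
  ∀ v : E, IsFace 𝕜 P {v} →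
    {F : Set E | IsFace 𝕜 P F ∧ dim 𝕜 F = 1 ∧ v ∈ F}.ncard = dim 𝕜 P

end Polytopes

section TypeA

/-- The simple reflection `s_{i+1} = (i+1, i+2)` of the Weyl group `S_{n+1}` of type `A_n`
(`Fin n` and `Fin (n + 1)` count from `0`). -/
def simpleReflection (n : ℕ) (i : Fin n) : Equiv.Perm (Fin (n + 1)) :=
  Equiv.swap i.castSucc i.succ

/-- The set `S = {s_1, …, s_n}` of simple reflections. -/
def simpleReflections (n : ℕ) : Set (Equiv.Perm (Fin (n + 1))) :=
  Set.range (simpleReflection n)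

/-- `J(k,n) = {s_{n-k+1}, …, s_n}`; the index of `simpleReflection n i` is `i + 1`, and
`n - k + 1 ≤ i + 1` is written without subtraction. -/
def terminalReflections (k n : ℕ) : Set (Equiv.Perm (Fin (n + 1))) :=
  {s | ∃ i : Fin n, n + 1 ≤ ((i : ℕ) + 1) + k ∧ s = simpleReflection n i}

variable {𝕜 : Type*} [Field 𝕜] [LinearOrder 𝕜] [IsStrictOrderedRing 𝕜]

/-- The action of `S_{n+1}` on `𝕜^{n+1}` by permutation of the coordinates:
`(w x)_{w j} = x_j`. -/
def weylAct {n : ℕ} (w : Equiv.Perm (Fin (n + 1))) (x : Fin (n + 1) → 𝕜) : Fin (n + 1) → 𝕜 :=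
  fun j => x (w⁻¹ j)

/-- The orbit polytope `P_lam = Conv(W · lam)`. -/
def orbitPolytope {n : ℕ} (lam : Fin (n + 1) → 𝕜) : Set (Fin (n + 1) → 𝕜) :=
  convexHull 𝕜 (Set.range fun w : Equiv.Perm (Fin (n + 1)) => weylAct w lam)

/-- `lam` is a dominant weight with `{s ∈ S | s lam = lam} = J`. Dominance means that all
coordinates decrease weakly. The coordinate sum of `lam` is arbitrary: subtracting its mean moves
`lam` into the span of the roots and translates the orbit polytope. -/
def IsDominantOfType {n : ℕ} (J : Set (Equiv.Perm (Fin (n + 1)))) (lam : Fin (n + 1) → 𝕜) : Prop :=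
  Antitone lam ∧ {s ∈ simpleReflections n | weylAct s lam = lam} = J

/-- Every set of simple reflections is the type of a dominant weight: take the sum of the
fundamental weights that belong to the other simple reflections. -/
theorem exists_isDominantOfType {n : ℕ} (J : Set (Equiv.Perm (Fin (n + 1))))
    (hJ : J ⊆ simpleReflections n) : ∃ lam : Fin (n + 1) → 𝕜, IsDominantOfType J lam := by
  classical
  let f : Fin (n + 1) → Fin n → 𝕜 := fun j i =>
    if simpleReflection n i ∉ J ∧ j ≤ i.castSucc then 1 else 0
  have key : ∀ i : Fin n, (∑ a, f i.castSucc a) - ∑ a, f i.succ a =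
      if simpleReflection n i ∉ J then 1 else 0 := by
    intro i
    rw [← Finset.sum_sub_distrib, Finset.sum_eq_single i]
    · have h1 : ¬ i.succ ≤ i.castSucc := by simp [Fin.le_def]
      simp [f, h1]
    · intro a _ ha
      have : i.castSucc ≤ a.castSucc ↔ i.succ ≤ a.castSucc := by
        have : (a : ℕ) ≠ i := fun h => ha (Fin.ext h)
        simp only [Fin.le_def, Fin.val_castSucc, Fin.val_succ]
        omega
      simp [f, this]
    · simp
  refine ⟨fun j => ∑ i, f j i, ?_, ?_⟩
  · intro a b hab
    refine Finset.sum_le_sum fun i _ => ?_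
    by_cases h : simpleReflection n i ∉ J ∧ b ≤ i.castSucc
    · simp [f, h.1, h.2, hab.trans h.2]
    · simp only [f, if_neg h]
      split_ifs <;> simp
  · ext s
    constructor
    · rintro ⟨⟨i, rfl⟩, h⟩
      have h2 := congrFun h i.castSucc
      simp only [weylAct, simpleReflection, Equiv.swap_inv, Equiv.swap_apply_left] at h2
      have h3 := key i
      rw [h2, sub_self] at h3
      by_contra hc
      rw [if_pos hc] at h3
      exact zero_ne_one h3
    · intro hs
      obtain ⟨i, rfl⟩ := hJ hs
      refine ⟨⟨i, rfl⟩, ?_⟩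
      have h3 := key i
      rw [if_neg (not_not.2 hs), sub_eq_zero] at h3
      funext j
      simp only [weylAct, simpleReflection, Equiv.swap_inv]
      by_cases h4 : j = i.castSucc
      · subst h4
        rw [Equiv.swap_apply_left]
        exact h3.symm
      · by_cases h5 : j = i.succ
        · subst h5
          rw [Equiv.swap_apply_right]
          exact h3
        · rw [Equiv.swap_apply_of_ne_of_ne h4 h5]

variable (𝕜) in
/-- `J` is combinatorially smooth: the orbit polytopes of type `J` are simple. -/
def CombinatoriallySmooth {n : ℕ} (J : Set (Equiv.Perm (Fin (n + 1)))) : Prop :=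
  ∀ lam : Fin (n + 1) → 𝕜, IsDominantOfType J lam → IsSimple 𝕜 (orbitPolytope lam)

end TypeA

section Eulerian

/-- The ascent set `{i | p_i < p_{i+1}}` of a permutation `(p_1, …, p_m)`. -/
def ascents {m : ℕ} (σ : Equiv.Perm (Fin m)) : Set (Fin m) :=
  {i | ∃ h : (i : ℕ) + 1 < m, σ i < σ ⟨(i : ℕ) + 1, h⟩}

/-- The Eulerian number `E(m,i)`: the number of permutations in `S_m` with exactly `i` ascents. -/
noncomputable def eulerianNumber (m i : ℕ) : ℕ :=
  {σ : Equiv.Perm (Fin m) | (ascents σ).ncard = i}.ncard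

/-- The `m`-th Eulerian polynomial `E_m(t) = ∑_i E(m,i) t^i`. For `m ≥ 1` the term `i = m` vanishes;
it gives `E_0 = 1`. -/
noncomputable def eulerianPoly (m : ℕ) : ℤ[X] :=
  ∑ i ∈ Finset.range (m + 1), C (eulerianNumber m i : ℤ) * X ^ i

end Eulerian

end OrbitPolytope

/-!
Maximising a linear functional with coefficients `-c` over the orbit of `lam` is, by the
rearrangement inequality, a matter of sorting `c`. So the faces of the orbit polytope of type
`J(k, n)` correspond to the ordered set partitions of the `n + 1` coordinates, where refinements of
the parts that start at a position `≥ m = n - k` are forgotten because `lam` is constant there. The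
dimension of a face is the sum of `#B - 1` over the remaining parts `B`, and the `h`-polynomial is
the generating polynomial of this statistic at `t - 1`.

Passing from `m` to `m + 1` amounts to splitting the last part of a partition. If exactly `m`
elements precede it, the choices are the nonempty subsets of a set with `k + 1` elements, and they
contribute `1 + t + ⋯ + t ^ k`; otherwise there is only one choice. The partitions with exactly `m`
elements before the last part consist of an `m`-subset of the coordinates and an ordered partition
of it. Sorting an ordered partition of `m` elements gives a permutation, and the partitions with a
given sorting permutation correspond to the subsets of its ascent set, whence the factor `E_m(t)`.

The vertices are permuted transitively by the symmetric group. A face through `lam` whose dimension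
is `d` is determined by the set of the `d` coordinates other than the first one in each of the
remaining parts `B`. If `m > 0`, every set of coordinates that omits the first one occurs, so the
edges through `lam` are as many as the dimension of the polytope.
-/

namespace OrbitPolytope

open Finset

section Rankings

variable {V α : Type*} [Fintype V] [LinearOrder α]

/-- The number of elements strictly below `j` in the preorder defined by `c`, truncated at `m`. It
records the ordered set partition into the level sets of `c`, up to refinements of the parts that
start at a position `≥ m`. -/
def truncRank (m : ℕ) (c : V → α) (j : V) : ℕ :=
  min m #{u | c u < c j}

theorem card_filter_lt_lt_iff (c : V → α) (u j : V) :
    #{w | c w < c u} < #{w | c w < c j} ↔ c u < c j := by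
  refine ⟨fun h => ?_, fun h => card_lt_card ?_⟩
  · contrapose! h
    exact card_le_card (monotone_filter_right _ fun w _ hw => lt_of_lt_of_le hw h)
  · rw [ssubset_iff_of_subset (monotone_filter_right _ fun w _ hw => lt_trans hw h)]
    exact ⟨u, by simpa using h, by simp⟩

theorem le_card_filter_card_lt {m : ℕ} (hm : m ≤ Fintype.card V) (c : V → α) :
    m ≤ #{u | #{w | c w < c u} < m} := by
  rcases ({u | m ≤ #{w | c w < c u}} : Finset V).eq_empty_or_nonempty with h | h
  · rwa [filter_true_of_mem fun u _ => not_le.1 (filter_eq_empty_iff.1 h (mem_univ u))]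
  · obtain ⟨v, hv, hmin⟩ := exists_min_image _ c h
    simp only [mem_filter_univ] at hv hmin
    refine hv.trans (card_le_card (monotone_filter_right _ fun u _ hu => ?_))
    exact lt_of_not_ge fun hmu => (hmin u hmu).not_gt hu

theorem truncRank_truncRank (m : ℕ) (c : V → α) :
    truncRank m (truncRank m c) = truncRank m c := by
  funext j
  simp only [truncRank]
  rcases le_or_gt #{u | c u < c j} m with hj | hj
  · simp only [min_eq_right hj, min_lt_iff, hj.not_gt, false_or, card_filter_lt_lt_iff]
  · have hm : m ≤ Fintype.card V := hj.le.trans (card_le_univ _)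
    simpa only [min_eq_left hj.le, min_lt_iff, lt_irrefl, false_or, min_eq_left_iff] using
      le_card_filter_card_lt hm c

/-- The functions `V → ℕ` that are their own truncated rank. They encode the ordered set partitions
of `V`, up to refinements of the parts that start at a position `≥ m`. -/
def rankings (V : Type*) [Fintype V] [DecidableEq V] (m : ℕ) : Finset (V → ℕ) :=
  {ρ ∈ Fintype.piFinset fun _ => range (m + 1) | truncRank m ρ = ρ}

/-- The sum of `#B - 1` over the parts `B` that start at a position `< m`. It is the dimension of
the face that `ρ` describes. -/
def rankDim (m : ℕ) (ρ : V → ℕ) : ℕ :=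
  ∑ p ∈ range m, (#{j | ρ j = p} - 1)

/-- The generating polynomial of `rankDim` on `rankings V m`, evaluated at `x`. -/
def rankSum (V : Type*) [Fintype V] [DecidableEq V] (m : ℕ) {R : Type*} [CommSemiring R] (x : R) :
    R :=
  ∑ ρ ∈ rankings V m, x ^ rankDim m ρ

variable [DecidableEq V] {m : ℕ} {ρ : V → ℕ}

theorem mem_rankings : ρ ∈ rankings V m ↔ truncRank m ρ = ρ := by
  simp only [rankings, mem_filter, Fintype.mem_piFinset, mem_range, and_iff_right_iff_imp]
  intro h j
  rw [← h, truncRank]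
  omega

theorem mem_rankings_iff_forall : ρ ∈ rankings V m ↔ ∀ j, min m #{u | ρ u < ρ j} = ρ j :=
  mem_rankings.trans funext_iff

theorem truncRank_mem_rankings (m : ℕ) (c : V → α) : truncRank m c ∈ rankings V m :=
  mem_rankings.2 (truncRank_truncRank m c)

theorem le_of_mem_rankings (hρ : ρ ∈ rankings V m) (j : V) : ρ j ≤ m := by
  rw [← mem_rankings_iff_forall.1 hρ j]
  exact min_le_left _ _

theorem card_filter_lt_of_mem_rankings (hρ : ρ ∈ rankings V m) {j : V} (hj : ρ j < m) :
    #{u | ρ u < ρ j} = ρ j := by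
  have := mem_rankings_iff_forall.1 hρ j
  omega

theorem le_card_filter_lt_of_mem_rankings (hρ : ρ ∈ rankings V m) (hm : m ≤ Fintype.card V) :
    m ≤ #{u | ρ u < m} := by
  refine (le_card_filter_card_lt hm ρ).trans
    (card_le_card (monotone_filter_right _ fun u _ hu => ?_))
  rw [← mem_rankings_iff_forall.1 hρ u]
  exact (min_le_right _ _).trans_lt hu

theorem lt_of_mem_rankings (hρ : ρ ∈ rankings V m) (hm : Fintype.card V ≤ m) (j : V) :
    ρ j < m := by
  rw [← mem_rankings_iff_forall.1 hρ j]
  exact (min_le_right _ _).trans_lt ((card_lt_univ_of_notMem (x := j) (by simp)).trans_le hm)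

end Rankings

section Restriction

variable {V W : Type*} [Fintype V] [Fintype W] {m : ℕ} {ρ : V → ℕ}

theorem card_filter_comp (e : W ↪ V) (p : V → Prop) [DecidablePred p]
    (hp : ∀ v, p v → v ∈ Set.range e) : #{i | p (e i)} = #{v | p v} := by
  refine card_nbij e (by simp [Set.MapsTo]) e.injective.injOn fun v hv => ?_
  obtain ⟨i, rfl⟩ := hp v (by simpa using hv)
  exact ⟨i, by simpa using hv, rfl⟩

theorem rankDim_comp (e : W ↪ V) (hρ : ∀ v, ρ v < m → v ∈ Set.range e) :
    rankDim m (ρ ∘ e) = rankDim m ρ := by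
  refine sum_congr rfl fun p hp => congrArg (· - 1) ?_
  exact card_filter_comp e (ρ · = p) fun v hv => hρ v (hv.trans_lt (mem_range.1 hp))

theorem rankDim_comp_equiv (e : W ≃ V) : rankDim m (ρ ∘ e) = rankDim m ρ :=
  rankDim_comp e.toEmbedding fun v _ => e.surjective v

theorem filter_extend_lt_eq_map (e : W ↪ V) {ρ : W → ℕ} (hρ : ∀ i, ρ i < m) :
    ({j | Function.extend e ρ (fun _ => m) j < m} : Finset V) = univ.map e := by
  ext v
  by_cases hv : ∃ i, e i = v
  · obtain ⟨i, rfl⟩ := hv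
    simp [e.injective.extend_apply, hρ]
  · simpa [Function.extend_apply' _ _ _ hv] using hv

variable [DecidableEq V] [DecidableEq W]

theorem comp_mem_rankings_iff (e : W ↪ V) (hρ : ∀ v ∉ Set.range e, ρ v = m)
    (hm : ∀ v ∉ Set.range e, m ≤ #{u | ρ u < m}) :
    ρ ∘ e ∈ rankings W m ↔ ρ ∈ rankings V m := by
  have card_comp (i : W) (hi : ρ (e i) ≤ m) :
      #{u | (ρ ∘ e) u < (ρ ∘ e) i} = #{v | ρ v < ρ (e i)} := by
    refine card_filter_comp e (ρ · < ρ (e i)) fun v hv => ?_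
    by_contra hve
    exact (hv.trans_le hi).ne (hρ v hve)
  refine ⟨fun h => mem_rankings_iff_forall.2 fun v => ?_,
    fun h => mem_rankings_iff_forall.2 fun i => ?_⟩
  · by_cases hv : v ∈ Set.range e
    · obtain ⟨i, rfl⟩ := hv
      rw [← card_comp i (le_of_mem_rankings h i)]
      exact mem_rankings_iff_forall.1 h i
    · rw [hρ v hv, min_eq_left (hm v hv)]
  · rw [card_comp i (le_of_mem_rankings h (e i))]
    exact mem_rankings_iff_forall.1 h (e i)

theorem comp_equiv_mem_rankings_iff (e : W ≃ V) : ρ ∘ e ∈ rankings W m ↔ ρ ∈ rankings V m :=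
  comp_mem_rankings_iff e.toEmbedding (fun v hv => absurd (e.surjective v) hv)
    fun v hv => absurd (e.surjective v) hv

theorem sum_rankings_filter_lt_eq_map {R : Type*} [CommSemiring R] (e : W ↪ V)
    (hm : Fintype.card W = m) (x : R) :
    ∑ ρ ∈ rankings V m with ({j | ρ j < m} : Finset V) = univ.map e, x ^ rankDim m ρ =
      rankSum W m x := by
  have le_card {ρ : V → ℕ} (hlt : ({j | ρ j < m} : Finset V) = univ.map e) :
      m ≤ #{j | ρ j < m} := by
    rw [hlt, card_map, card_univ, hm]
  have lt_iff {ρ : V → ℕ} (hlt : ({j | ρ j < m} : Finset V) = univ.map e) (v : V) :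
      ρ v < m ↔ v ∈ Set.range e := by
    simpa using Finset.ext_iff.1 hlt v
  have eq_of_notMem {ρ : V → ℕ} (hρ : ρ ∈ rankings V m)
      (hlt : ({j | ρ j < m} : Finset V) = univ.map e) (v : V) (hv : v ∉ Set.range e) : ρ v = m :=
    (le_of_mem_rankings hρ v).antisymm (not_lt.1 ((lt_iff hlt v).not.2 hv))
  refine sum_nbij (· ∘ e) (fun ρ h => ?_) (fun ρ h ρ' h' hcomp => ?_) (fun ρ hρ => ?_)
    fun ρ h => ?_
  · obtain ⟨hρ, hlt⟩ := mem_filter.1 h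
    exact (comp_mem_rankings_iff e (eq_of_notMem hρ hlt) fun _ _ => le_card hlt).2 hρ
  · obtain ⟨hρ, hlt⟩ := mem_filter.1 h
    obtain ⟨hρ', hlt'⟩ := mem_filter.1 h'
    funext v
    by_cases hv : v ∈ Set.range e
    · obtain ⟨i, rfl⟩ := hv
      exact congrFun hcomp i
    · rw [eq_of_notMem hρ hlt v hv, eq_of_notMem hρ' hlt' v hv]
  · have hlt := filter_extend_lt_eq_map e (lt_of_mem_rankings hρ hm.le)
    have hcomp : Function.extend e ρ (fun _ => m) ∘ e = ρ := Function.extend_comp e.injective _ _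
    refine ⟨_, mem_filter.2 ⟨?_, hlt⟩, hcomp⟩
    refine (comp_mem_rankings_iff e (fun v hv => ?_) fun _ _ => le_card hlt).1 (by rwa [hcomp])
    exact Function.extend_apply' _ _ _ hv
  · rw [rankDim_comp e fun v hv => (lt_iff (mem_filter.1 h).2 v).1 hv]

theorem sum_rankings_card_filter_lt_eq {R : Type*} [CommSemiring R] (m : ℕ) (x : R) :
    ∑ ρ ∈ rankings V m with #{j | ρ j < m} = m, x ^ rankDim m ρ =
      (Fintype.card V).choose m * rankSum (Fin m) m x := by
  have fiber (A : Finset V) (hA : A ∈ powersetCard m univ) :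
      ∑ ρ ∈ rankings V m with #{j | ρ j < m} = m ∧ ({j | ρ j < m} : Finset V) = A,
        x ^ rankDim m ρ = rankSum (Fin m) m x := by
    have hcard := (mem_powersetCard.1 hA).2
    let e : Fin m ↪ V := (A.equivFinOfCardEq hcard).symm.toEmbedding.trans (.subtype _)
    have he : univ.map e = A := by
      rw [← map_map, map_univ_equiv, univ_eq_attach, attach_map_val]
    rw [← sum_rankings_filter_lt_eq_map e (Fintype.card_fin m), he]
    refine sum_congr (filter_congr fun ρ _ => and_iff_right_of_imp ?_) fun _ _ => rfl
    rintro rfl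
    exact hcard
  rw [← sum_fiberwise_of_maps_to (t := powersetCard m univ)
    (g := fun ρ => ({j | ρ j < m} : Finset V))]
  · simp only [filter_filter]
    rw [sum_congr rfl fiber, sum_const, card_powersetCard, card_univ, nsmul_eq_mul]
  · exact fun ρ hρ => mem_powersetCard.2 ⟨subset_univ _, (mem_filter.1 hρ).2⟩

end Restriction

section Recursion

theorem sum_powerset_filter_nonempty {ι R : Type*} [CommSemiring R] (s : Finset ι) (x : R) :
    ∑ B ∈ s.powerset with B.Nonempty, x ^ (#B - 1) = ∑ i ∈ range #s, (x + 1) ^ i := by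
  classical
  induction s using Finset.induction with
  | empty => simp [sum_filter]
  | insert a s ha ih =>
    have sum_insert : ∑ B ∈ s.powerset, x ^ (#(insert a B) - 1) = (x + 1) ^ #s := by
      rw [← sum_pow_mul_eq_add_pow x 1 s]
      refine sum_congr rfl fun B hB => ?_
      rw [card_insert_of_notMem fun h => ha (mem_powerset.1 hB h), add_tsub_cancel_right, one_pow,
        mul_one]
    rw [sum_filter, sum_powerset_insert ha, ← sum_filter, ih, card_insert_of_notMem ha,
      sum_range_succ, ← sum_insert]
    simp only [insert_nonempty, if_true]

variable {V : Type*} [Fintype V] [DecidableEq V] {m : ℕ} {ρ ρ' : V → ℕ} {B : Finset V}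

/-- The ranking that refines `ρ`, truncated at `m`, to one truncated at `m + 1` by splitting off
the part `B` from the elements of rank `≥ m`. -/
def refineRank (m : ℕ) (ρ : V → ℕ) (B : Finset V) (j : V) : ℕ :=
  if ρ j < m then ρ j else if j ∈ B then m else m + 1

theorem truncRank_of_mem_rankings_succ (hρ' : ρ' ∈ rankings V (m + 1)) (j : V) :
    truncRank m ρ' j = min m (ρ' j) := by
  have := mem_rankings_iff_forall.1 hρ' j
  rw [truncRank]
  omega

omit [Fintype V] in
theorem refineRank_lt_iff {p : ℕ} (hp : p ≤ m) (j : V) : refineRank m ρ B j < p ↔ ρ j < p := by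
  rw [refineRank]
  split_ifs <;> omega

theorem card_filter_refineRank_lt_succ (hB : ∀ j ∈ B, ρ j = m) :
    #{j | refineRank m ρ B j < m + 1} = #{j | ρ j < m} + #B := by
  have hdisj : Disjoint ({j | ρ j < m} : Finset V) B :=
    disjoint_left.2 fun j hj hjB => (mem_filter_univ j |>.1 hj).ne (hB j hjB)
  rw [← card_union_of_disjoint hdisj]
  congr 1
  ext j
  have := hB j
  simp only [mem_filter, mem_univ, true_and, mem_union, refineRank]
  grind

theorem refineRank_mem_rankings_iff (hρ : ρ ∈ rankings V m) (hm : m < Fintype.card V)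
    (hB : ∀ j ∈ B, ρ j = m) :
    refineRank m ρ B ∈ rankings V (m + 1) ↔ (B.Nonempty ↔ #{j | ρ j < m} = m) := by
  have hcard := le_card_filter_lt_of_mem_rankings hρ hm.le
  have refineRank_mem {j : V} (hj : j ∈ B) : refineRank m ρ B j = m := by
    simp [refineRank, hB j hj, hj]
  have refineRank_notMem {j : V} (hj : m ≤ ρ j) (hjB : j ∉ B) : refineRank m ρ B j = m + 1 := by
    simp [refineRank, hj.not_gt, hjB]
  have card_lt : #{j | refineRank m ρ B j < m} = #{j | ρ j < m} := by
    simp only [refineRank_lt_iff le_rfl]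
  rw [mem_rankings_iff_forall]
  constructor
  · refine fun h => ⟨fun ⟨j, hj⟩ => ?_, fun hcard_eq => ?_⟩
    · have := h j
      rw [refineRank_mem hj, card_lt] at this
      omega
    · by_contra hB_empty
      obtain ⟨j, hj⟩ : ∃ j, j ∉ ({j | ρ j < m} : Finset V) := by
        by_contra! hall
        exact hm.ne' (by rw [← hcard_eq, eq_univ_of_forall hall, card_univ])
      have := h j
      rw [not_nonempty_iff_eq_empty] at hB_empty
      rw [refineRank_notMem (by simpa using hj) (by simp [hB_empty]),
        card_filter_refineRank_lt_succ hB, hB_empty, card_empty] at this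
      omega
  · intro h j
    by_cases hj : ρ j < m
    · have hval : refineRank m ρ B j = ρ j := if_pos hj
      simp only [hval, refineRank_lt_iff hj.le, card_filter_lt_of_mem_rankings hρ hj]
      omega
    · by_cases hjB : j ∈ B
      · rw [refineRank_mem hjB, card_lt, h.1 ⟨j, hjB⟩]
        omega
      · rw [refineRank_notMem (not_lt.1 hj) hjB, card_filter_refineRank_lt_succ hB]
        have := card_pos.trans h
        omega

theorem rankDim_refineRank (hB : ∀ j ∈ B, ρ j = m) :
    rankDim (m + 1) (refineRank m ρ B) = rankDim m ρ + (#B - 1) := by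
  rw [rankDim, sum_range_succ]
  congr 1
  · refine sum_congr rfl fun p hp => ?_
    congr 2
    ext j
    have := mem_range.1 hp
    simp only [mem_filter, mem_univ, true_and, refineRank]
    grind
  · congr 2
    ext j
    have := hB j
    grind [refineRank]

theorem refineRank_filter_eq (hρ' : ρ' ∈ rankings V (m + 1)) :
    refineRank m (truncRank m ρ') {j | ρ' j = m} = ρ' := by
  funext j
  have := le_of_mem_rankings hρ' j
  simp only [refineRank, truncRank_of_mem_rankings_succ hρ', mem_filter, mem_univ, true_and]
  grind

theorem filter_refineRank_eq (hB : ∀ j ∈ B, ρ j = m) :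
    ({j | refineRank m ρ B j = m} : Finset V) = B := by
  ext j
  have := hB j
  grind [refineRank]

theorem truncRank_refineRank (hρ : ρ ∈ rankings V m)
    (hmem : refineRank m ρ B ∈ rankings V (m + 1)) :
    truncRank m (refineRank m ρ B) = ρ := by
  funext j
  have := le_of_mem_rankings hρ j
  rw [truncRank_of_mem_rankings_succ hmem, refineRank]
  grind

theorem sum_filter_truncRank_eq (hρ : ρ ∈ rankings V m) (hm : m < Fintype.card V) {R : Type*}
    [CommSemiring R] (x : R) :
    ∑ ρ' ∈ rankings V (m + 1) with truncRank m ρ' = ρ, x ^ rankDim (m + 1) ρ' =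
      x ^ rankDim m ρ *
        ∑ B ∈ powerset {j | ρ j = m} with (B.Nonempty ↔ #{j | ρ j < m} = m), x ^ (#B - 1) := by
  have mem_iff {B : Finset V} : B ∈ powerset {j | ρ j = m} ↔ ∀ j ∈ B, ρ j = m := by
    simp [subset_iff]
  rw [mul_sum]
  symm
  refine sum_nbij' (refineRank m ρ) (fun ρ' => ({j | ρ' j = m} : Finset V)) (fun B hB => ?_)
    (fun ρ' h => ?_) (fun B hB => ?_) (fun ρ' h => ?_) fun B hB => ?_
  · simp only [mem_filter, mem_iff] at hB ⊢
    have hmem := (refineRank_mem_rankings_iff hρ hm hB.1).2 hB.2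
    exact ⟨hmem, truncRank_refineRank hρ hmem⟩
  · obtain ⟨hρ', rfl⟩ := mem_filter.1 h
    have hB : ∀ j ∈ ({j | ρ' j = m} : Finset V), truncRank m ρ' j = m := fun j hj => by
      rw [truncRank_of_mem_rankings_succ hρ', (mem_filter_univ j).1 hj, min_self]
    refine mem_filter.2 ⟨mem_iff.2 hB, (refineRank_mem_rankings_iff hρ hm hB).1 ?_⟩
    rwa [refineRank_filter_eq hρ']
  · exact filter_refineRank_eq (mem_iff.1 (mem_filter.1 hB).1)
  · obtain ⟨hρ', rfl⟩ := mem_filter.1 h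
    exact refineRank_filter_eq hρ'
  · rw [rankDim_refineRank (mem_iff.1 (mem_filter.1 hB).1), pow_add]

theorem sum_powerset_filter_eq (hρ : ρ ∈ rankings V m) (hm : m < Fintype.card V) {R : Type*}
    [CommSemiring R] (x : R) :
    ∑ B ∈ powerset {j | ρ j = m} with (B.Nonempty ↔ #{j | ρ j < m} = m), x ^ (#B - 1) =
      1 + if #{j | ρ j < m} = m then ∑ i ∈ range (Fintype.card V - (m + 1)), (x + 1) ^ (i + 1)
        else 0 := by
  split_ifs with hcard
  · have hadd := card_filter_add_card_filter_not (s := univ) fun j => ρ j < m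
    have htop : #{j | ¬ ρ j < m} = #{j | ρ j = m} :=
      congrArg card (filter_congr fun j _ => by have := le_of_mem_rankings hρ j; omega)
    have hsucc : #{j | ρ j = m} = Fintype.card V - (m + 1) + 1 := by
      rw [htop, hcard, card_univ] at hadd
      omega
    simp only [hcard, iff_true]
    rw [sum_powerset_filter_nonempty, hsucc, sum_range_succ', pow_zero, add_comm]
  · simp only [hcard, iff_false, not_nonempty_iff_eq_empty]
    rw [filter_eq', if_pos (empty_mem_powerset _)]
    simp

theorem rankSum_succ (hm : m < Fintype.card V) {R : Type*} [CommSemiring R] (x : R) :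
    rankSum V (m + 1) x = rankSum V m x + (Fintype.card V).choose m *
      (∑ i ∈ range (Fintype.card V - (m + 1)), (x + 1) ^ (i + 1)) * rankSum (Fin m) m x := by
  rw [mul_right_comm, ← sum_rankings_card_filter_lt_eq, sum_mul, sum_filter, rankSum, rankSum,
    ← sum_add_distrib,
    ← sum_fiberwise_of_maps_to fun ρ' _ => truncRank_mem_rankings (α := ℕ) m ρ']
  refine sum_congr rfl fun ρ hρ => ?_
  rw [sum_filter_truncRank_eq hρ hm, sum_powerset_filter_eq hρ hm, mul_add, mul_one, mul_ite,
    mul_zero]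

end Recursion

section BelowIdentity

variable {N m : ℕ}

theorem card_filter_perm_lt (σ : Equiv.Perm (Fin N)) {p : ℕ} (hp : p ≤ N) :
    #{u | (σ u : ℕ) < p} = p := by
  have := card_filter_comp σ.toEmbedding (fun i : Fin N => (i : ℕ) < p) fun v _ => σ.surjective v
  rwa [Fin.card_filter_val_lt, min_eq_right hp] at this

theorem lt_iff_perm_lt_card {α : Type*} [LinearOrder α] {c : Fin N → α} {σ : Equiv.Perm (Fin N)}
    (hσ : ∀ j, truncRank m c j ≤ σ j) {j : Fin N} (hj : #{w | c w < c j} ≤ m) (u : Fin N) :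
    c u < c j ↔ (σ u : ℕ) < #{w | c w < c j} := by
  have hsub : ({w | (σ w : ℕ) < #{w | c w < c j}} : Finset (Fin N)) ⊆
      ({w | c w < c j} : Finset (Fin N)) := by
    refine monotone_filter_right _ fun w _ hw => ?_
    by_contra hwj
    have := (card_filter_lt_lt_iff c w j).not.2 hwj
    have := hσ w
    rw [truncRank] at this
    omega
  have hcard := card_filter_perm_lt σ ((card_filter_le univ fun w => c w < c j).trans_eq (by simp))
  have heq := eq_of_subset_of_card_le hsub hcard.ge
  simpa using (Finset.ext_iff.1 heq u).symm

variable {ρ ρ' : Fin N → ℕ}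

theorem lt_apply_iff_perm_lt (hρ : ρ ∈ rankings (Fin N) m) {σ : Equiv.Perm (Fin N)}
    (hσ : ∀ j, ρ j ≤ σ j) {j : Fin N} (hj : ρ j < m) (u : Fin N) : ρ u < ρ j ↔ σ u < ρ j := by
  have hcard := card_filter_lt_of_mem_rankings hρ hj
  have := lt_iff_perm_lt_card (σ := σ) (by rwa [mem_rankings.1 hρ]) (hcard.trans_le hj.le) u
  rwa [hcard] at this

theorem lt_apply_iff_lt (hρ : ρ ∈ rankings (Fin N) m) (hle : ∀ j, ρ j ≤ j) {j : Fin N}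
    (hj : ρ j < m) (u : Fin N) : ρ u < ρ j ↔ u < ρ j :=
  lt_apply_iff_perm_lt hρ (σ := 1) hle hj u

theorem apply_apply_eq (hρ : ρ ∈ rankings (Fin N) m) (hle : ∀ j, ρ j ≤ j) {j : Fin N}
    (hj : ρ j < m) : ρ ⟨ρ j, (hle j).trans_lt j.2⟩ = ρ j :=
  (hle _).antisymm (not_lt.1 ((lt_apply_iff_lt hρ hle hj _).not.2 (lt_irrefl _)))

/-- The elements to which `ρ` gives less than the largest possible rank `min m j`, for rankings
below the identity. They are the elements other than the first one in the parts of `ρ` that start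
at a position `< m`. -/
def lowered (m : ℕ) (ρ : Fin N → ℕ) : Finset (Fin N) :=
  {j | ρ j < min m j}

theorem mem_lowered {j : Fin N} : j ∈ lowered m ρ ↔ ρ j < min m j := by
  simp [lowered]

theorem rankDim_eq_card_lowered (hρ : ρ ∈ rankings (Fin N) m) (hle : ∀ j, ρ j ≤ j) :
    rankDim m ρ = #(lowered m ρ) := by
  rw [rankDim, card_eq_sum_card_fiberwise (f := ρ) (t := range m) fun j hj => mem_range.2
    ((mem_lowered.1 hj).trans_le (min_le_left _ _))]
  refine sum_congr rfl fun p hp => ?_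
  rcases ({j | ρ j = p} : Finset (Fin N)).eq_empty_or_nonempty with hempty | ⟨j, hj⟩
  · rw [hempty, eq_comm]
    exact card_eq_zero.2 (subset_empty.1 (hempty ▸ filter_subset_filter _ (subset_univ _)))
  · obtain rfl := (mem_filter_univ j).1 hj
    have hfix := apply_apply_eq hρ hle (mem_range.1 hp)
    rw [← card_erase_of_mem (s := {i | ρ i = ρ j}) (mem_filter.2 ⟨mem_univ _, hfix⟩)]
    congr 1
    ext i
    have := hle i
    simp only [mem_erase, mem_filter, mem_univ, true_and, mem_lowered, ne_eq, Fin.ext_iff]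
    have := mem_range.1 hp
    omega

theorem le_of_lowered_subset (hρ : ρ ∈ rankings (Fin N) m) (hle : ∀ j, ρ j ≤ j)
    (hρ' : ρ' ∈ rankings (Fin N) m) (hle' : ∀ j, ρ' j ≤ j) (h : lowered m ρ' ⊆ lowered m ρ) :
    ∀ j, ρ j ≤ ρ' j := by
  have le_of_notMem {j : Fin N} (hj : min m j ≤ ρ j) : min m j ≤ ρ' j :=
    not_lt.1 fun hlt => hj.not_gt (mem_lowered.1 (h (mem_lowered.2 hlt)))
  intro j
  have hj_le := hle j
  rcases (le_of_mem_rankings hρ j).lt_or_eq with hj | hj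
  · set p : Fin N := ⟨ρ j, hj_le.trans_lt j.2⟩
    have hp : ρ' p = ρ j := by
      refine (hle' p).antisymm ?_
      have := le_of_notMem (j := p) ((min_le_right _ _).trans (apply_apply_eq hρ hle hj).ge)
      rwa [min_eq_right (show (p : ℕ) ≤ m from hj.le)] at this
    rw [← hp, ← not_lt, lt_apply_iff_lt hρ' hle' (hp.trans_lt hj), hp, not_lt]
    exact hj_le
  · have := le_of_notMem (j := j) (by omega)
    omega

/-- The ranking below the identity with the set of lowered elements `T`. -/
def rankOfLowered (m : ℕ) (T : Finset (Fin N)) (j : Fin N) : ℕ :=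
  if j ∈ T then ({p | p ∉ T ∧ (p : ℕ) < min m j} : Finset (Fin N)).sup Fin.val else min m j

variable {T : Finset (Fin N)}

theorem rankOfLowered_le (m : ℕ) (T : Finset (Fin N)) (j : Fin N) :
    rankOfLowered m T j ≤ min m j := by
  rw [rankOfLowered]
  split_ifs
  · exact Finset.sup_le fun p hp => (mem_filter.1 hp).2.2.le
  · exact le_rfl

theorem le_rankOfLowered {p j : Fin N} (hp : p ∉ T) (hpm : (p : ℕ) < m) (hpj : p ≤ j) :
    (p : ℕ) ≤ rankOfLowered m T j := by
  rw [rankOfLowered]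
  split_ifs with hj
  · have hne : (p : ℕ) ≠ j := fun h => hp (Fin.ext h ▸ hj)
    refine Finset.le_sup (f := Fin.val) (mem_filter.2 ⟨mem_univ p, hp, ?_⟩)
    exact lt_min hpm (lt_of_le_of_ne hpj hne)
  · exact le_min hpm.le hpj

theorem exists_notMem_eq_rankOfLowered (hT : T ⊆ lowered m 0) {j : Fin N}
    (hj : rankOfLowered m T j < m) : ∃ p ∉ T, (p : ℕ) = rankOfLowered m T j := by
  rw [rankOfLowered] at hj ⊢
  split_ifs at hj ⊢ with hjT
  · have hj_pos := mem_lowered.1 (hT hjT)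
    have hzero : (⟨0, j.pos⟩ : Fin N) ∉ T := fun h => by simpa using mem_lowered.1 (hT h)
    obtain ⟨p, hp, hsup⟩ := exists_mem_eq_sup ({p | p ∉ T ∧ (p : ℕ) < min m j} : Finset (Fin N))
      ⟨_, mem_filter.2 ⟨mem_univ _, hzero, hj_pos⟩⟩ Fin.val
    exact ⟨p, (mem_filter.1 hp).2.1, hsup.symm⟩
  · exact ⟨j, hjT, by omega⟩

theorem rankOfLowered_mem_rankings (hT : T ⊆ lowered m 0) :
    rankOfLowered m T ∈ rankings (Fin N) m := by
  refine mem_rankings_iff_forall.2 fun j => ?_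
  have hle := rankOfLowered_le m T
  have hj := hle j
  have hcard : #{u : Fin N | (u : ℕ) < rankOfLowered m T j} = rankOfLowered m T j := by
    rw [Fin.card_filter_val_lt]
    omega
  have hcard_le : rankOfLowered m T j ≤ #{u | rankOfLowered m T u < rankOfLowered m T j} := by
    refine hcard.ge.trans (card_le_card (monotone_filter_right _ fun u _ hu => ?_))
    exact ((hle u).trans (min_le_right _ _)).trans_lt hu
  rcases (hj.trans (min_le_left _ _)).lt_or_eq with hjm | hjm
  · obtain ⟨p, hpT, hp⟩ := exists_notMem_eq_rankOfLowered hT hjm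
    have hcard_ge : #{u | rankOfLowered m T u < rankOfLowered m T j} ≤ rankOfLowered m T j := by
      refine (card_le_card (monotone_filter_right _ fun u _ hu => ?_)).trans hcard.le
      rw [← hp] at hu hjm ⊢
      exact not_le.1 fun hpu => hu.not_ge (le_rankOfLowered hpT hjm hpu)
    omega
  · omega

theorem lowered_rankOfLowered (hT : T ⊆ lowered m 0) : lowered m (rankOfLowered m T) = T := by
  ext j
  rw [mem_lowered, rankOfLowered]
  split_ifs with hj
  · simp only [hj, iff_true]
    exact (Finset.sup_lt_iff (mem_lowered.1 (hT hj))).2 fun p hp => (mem_filter.1 hp).2.2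
  · simp [hj]

theorem zero_mem_rankings {V : Type*} [Fintype V] [DecidableEq V] (m : ℕ) :
    0 ∈ rankings V m :=
  mem_rankings_iff_forall.2 fun j => by simp

theorem lowered_subset_lowered_zero (m : ℕ) (ρ : Fin N → ℕ) : lowered m ρ ⊆ lowered m 0 :=
  fun _ hj => mem_lowered.2 ((Nat.zero_le _).trans_lt (mem_lowered.1 hj))

theorem bijOn_lowered (N m : ℕ) :
    Set.BijOn (lowered m) {ρ : Fin N → ℕ | ρ ∈ rankings (Fin N) m ∧ ∀ j, ρ j ≤ j}
      {T | T ⊆ lowered m 0} := by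
  refine ⟨fun ρ _ => lowered_subset_lowered_zero m ρ, fun ρ hρ ρ' hρ' h => ?_, fun T hT => ?_⟩
  · funext j
    exact (le_of_lowered_subset hρ.1 hρ.2 hρ'.1 hρ'.2 h.ge j).antisymm
      (le_of_lowered_subset hρ'.1 hρ'.2 hρ.1 hρ.2 h.le j)
  · exact ⟨_, ⟨rankOfLowered_mem_rankings hT, fun j => (rankOfLowered_le m T j).trans
      (min_le_right _ _)⟩, lowered_rankOfLowered hT⟩

theorem card_filter_le_and_rankDim_eq_one (N m : ℕ) :
    #{ρ ∈ rankings (Fin N) m | (∀ j : Fin N, ρ j ≤ (j : ℕ)) ∧ rankDim m ρ = 1} =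
      #(lowered (N := N) m 0) := by
  obtain ⟨hmaps, hinj, hsurj⟩ := bijOn_lowered N m
  rw [← Nat.choose_one_right #(lowered m 0), ← card_powersetCard]
  refine card_nbij (lowered m) (fun ρ h => ?_) (hinj.mono fun ρ h => ?_) fun T hT => ?_
  · obtain ⟨hρ, hle, hdim⟩ := mem_filter.1 h
    exact mem_powersetCard.2 ⟨hmaps ⟨hρ, hle⟩, rankDim_eq_card_lowered hρ hle ▸ hdim⟩
  · exact ⟨(mem_filter.1 h).1, (mem_filter.1 h).2.1⟩
  · obtain ⟨hsub, hcard⟩ := mem_powersetCard.1 hT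
    obtain ⟨ρ, ⟨hρ, hle⟩, rfl⟩ := hsurj hsub
    exact ⟨ρ, mem_filter.2 ⟨hρ, hle, rankDim_eq_card_lowered hρ hle ▸ hcard⟩, rfl⟩

theorem sum_filter_le_and_lowered_subset {A : Finset (Fin N)} (hA : A ⊆ lowered m 0) {R : Type*}
    [CommSemiring R] (x : R) :
    ∑ ρ ∈ rankings (Fin N) m with (∀ j : Fin N, ρ j ≤ (j : ℕ)) ∧ lowered m ρ ⊆ A, x ^ rankDim m ρ =
      (x + 1) ^ #A := by
  obtain ⟨-, hinj, hsurj⟩ := bijOn_lowered N m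
  rw [← sum_pow_mul_eq_add_pow]
  refine sum_nbij (lowered m) (fun ρ h => ?_) (hinj.mono fun ρ h => ?_) (fun T hT => ?_)
    fun ρ h => ?_
  · exact mem_powerset.2 (mem_filter.1 h).2.2
  · exact ⟨(mem_filter.1 h).1, (mem_filter.1 h).2.1⟩
  · have hT := mem_powerset.1 hT
    obtain ⟨ρ, ⟨hρ, hle⟩, rfl⟩ := hsurj (hT.trans hA)
    exact ⟨ρ, mem_filter.2 ⟨hρ, hle, hT⟩, rfl⟩
  · obtain ⟨hρ, hle, -⟩ := mem_filter.1 h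
    rw [rankDim_eq_card_lowered hρ hle, one_pow, mul_one]

end BelowIdentity

section Eulerian

variable {m : ℕ} {ρ : Fin m → ℕ} {σ : Equiv.Perm (Fin m)}

theorem le_of_monotone_of_mem_rankings (hρ : ρ ∈ rankings (Fin m) m) (hmono : Monotone ρ)
    (j : Fin m) : ρ j ≤ j := by
  have hcard : #{u : Fin m | (u : ℕ) < j} = j := by
    rw [Fin.card_filter_val_lt, min_eq_right j.2.le]
  rw [← mem_rankings_iff_forall.1 hρ j, ← hcard]
  exact (min_le_right _ _).trans
    (card_le_card (monotone_filter_right _ fun u _ hu => hmono.reflect_lt hu))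

theorem monotone_of_le_of_mem_rankings (hρ : ρ ∈ rankings (Fin m) m)
    (hle : ∀ j, ρ j ≤ j) : Monotone ρ := by
  intro i j hij
  rw [← not_lt, lt_apply_iff_lt hρ hle ((hle i).trans_lt i.2), not_lt]
  exact (hle i).trans hij

theorem mem_lowered_iff_of_covBy (hρ : ρ ∈ rankings (Fin m) m) (hle : ∀ j, ρ j ≤ j) {i j : Fin m}
    (hij : i ⋖ j) : j ∈ lowered m ρ ↔ ρ i = ρ j := by
  have hi := hle i
  have hj := hle j
  have hmono := monotone_of_le_of_mem_rankings hρ hle hij.le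
  have hiff := lt_apply_iff_lt hρ hle (hj.trans_lt j.2) i
  have hsucc := Nat.covBy_iff_add_one_eq.1 (Fin.covBy_iff.1 hij)
  rw [mem_lowered]
  omega

open Classical in
/-- The positions `j` such that `σ` ascends from `j - 1` to `j`. -/
noncomputable def ascentTops (σ : Equiv.Perm (Fin m)) : Finset (Fin m) :=
  {j | ∃ i, i ⋖ j ∧ σ i < σ j}

theorem mem_ascentTops {j : Fin m} : j ∈ ascentTops σ ↔ ∃ i, i ⋖ j ∧ σ i < σ j := by
  simp [ascentTops]

theorem ascentTops_subset (σ : Equiv.Perm (Fin m)) : ascentTops σ ⊆ lowered m 0 := by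
  intro j hj
  obtain ⟨i, hij, -⟩ := mem_ascentTops.1 hj
  exact mem_lowered.2 (lt_min j.pos ((Nat.zero_le i).trans_lt hij.lt))

theorem card_ascentTops (σ : Equiv.Perm (Fin m)) : #(ascentTops σ) = (ascents σ).ncard := by
  rw [← Set.ncard_coe_finset]
  symm
  refine Set.ncard_congr (fun i hi => ⟨i + 1, hi.1⟩) (fun i hi => ?_) (fun i i' _ _ h => ?_)
    fun j hj => ?_
  · exact mem_ascentTops.2 ⟨i, Fin.covBy_iff.2 (Nat.covBy_iff_add_one_eq.2 rfl), hi.2⟩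
  · exact Fin.ext (Nat.succ_injective (Fin.ext_iff.1 h))
  · obtain ⟨i, hij, hlt⟩ := mem_ascentTops.1 hj
    have hsucc : (i : ℕ) + 1 = j := Nat.covBy_iff_add_one_eq.1 (Fin.covBy_iff.1 hij)
    have hj' : (⟨i + 1, hsucc ▸ j.2⟩ : Fin m) = j := Fin.ext hsucc
    exact ⟨i, ⟨_, hlt.trans_eq (congrArg σ hj'.symm)⟩, hj'⟩

theorem sort_eq_iff (hρ : ρ ∘ σ ∈ rankings (Fin m) m) :
    Tuple.sort ρ = σ ↔ (∀ j, (ρ ∘ σ) j ≤ j) ∧ lowered m (ρ ∘ σ) ⊆ ascentTops σ := by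
  rw [eq_comm, Tuple.eq_sort_iff]
  constructor
  · rintro ⟨hmono, hties⟩
    have hle := le_of_monotone_of_mem_rankings hρ hmono
    refine ⟨hle, fun j hj => ?_⟩
    have hpos : 0 < (j : ℕ) :=
      (Nat.zero_le _).trans_lt ((mem_lowered.1 hj).trans_le (min_le_right _ _))
    obtain ⟨i, hij⟩ : ∃ i : Fin m, i ⋖ j :=
      ⟨⟨j - 1, by omega⟩, Fin.covBy_iff.2 (Nat.covBy_iff_add_one_eq.2 (Nat.sub_add_cancel hpos))⟩
    exact mem_ascentTops.2
      ⟨i, hij, hties i j hij.lt ((mem_lowered_iff_of_covBy hρ hle hij).1 hj)⟩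
  · rintro ⟨hle, hsub⟩
    have hmono := monotone_of_le_of_mem_rankings hρ hle
    refine ⟨hmono, fun i j hij htie => ?_⟩
    have hord : ((ρ ∘ σ) ⁻¹' {ρ (σ j)}).OrdConnected :=
      Set.ordConnected_singleton.preimage_mono hmono
    refine strictMonoOn_of_lt_succ (f := σ) hord (fun a ha hmem hmem' => ?_) htie rfl hij
    have hcov := Order.covBy_succ_of_not_isMax ha
    have hlow := (mem_lowered_iff_of_covBy hρ hle hcov).2 (hmem.trans hmem'.symm)
    obtain ⟨b, hb, hlt⟩ := mem_ascentTops.1 (hsub hlow)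
    rwa [hb.unique_left hcov] at hlt

theorem sum_filter_sort_eq (σ : Equiv.Perm (Fin m)) {R : Type*} [CommSemiring R] (x : R) :
    ∑ ρ ∈ rankings (Fin m) m with Tuple.sort ρ = σ, x ^ rankDim m ρ =
      (x + 1) ^ (ascents σ).ncard := by
  rw [← card_ascentTops, ← sum_filter_le_and_lowered_subset (ascentTops_subset σ)]
  refine sum_equiv (σ.symm.arrowCongr (.refl ℕ)) (fun ρ => ?_) fun ρ _ => ?_
  · change _ ↔ ρ ∘ σ ∈ _
    simp only [mem_filter, comp_equiv_mem_rankings_iff]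
    exact and_congr_right fun hρ => sort_eq_iff ((comp_equiv_mem_rankings_iff σ).2 hρ)
  · exact congrArg _ (rankDim_comp_equiv σ).symm

theorem rankSum_fin (m : ℕ) {R : Type*} [CommSemiring R] (x : R) :
    rankSum (Fin m) m x = ∑ σ : Equiv.Perm (Fin m), (x + 1) ^ (ascents σ).ncard := by
  rw [rankSum, ← sum_fiberwise _ Tuple.sort]
  exact sum_congr rfl fun σ _ => sum_filter_sort_eq σ x

theorem eulerianPoly_eq_sum (m : ℕ) :
    eulerianPoly m = ∑ σ : Equiv.Perm (Fin m), (X : ℤ[X]) ^ (ascents σ).ncard := by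
  classical
  have hmaps (σ : Equiv.Perm (Fin m)) (_ : σ ∈ univ) : (ascents σ).ncard ∈ range (m + 1) := by
    have := Set.ncard_le_card (ascents σ)
    rw [Nat.card_eq_fintype_card, Fintype.card_fin] at this
    exact mem_range.2 (by omega)
  rw [← sum_fiberwise_of_maps_to hmaps, eulerianPoly]
  refine sum_congr rfl fun i _ => ?_
  rw [sum_congr rfl fun σ hσ => by rw [(mem_filter.1 hσ).2], sum_const, eulerianNumber,
    Set.ncard_eq_toFinset_card']
  simp

theorem rankSum_fin_sub_one (m : ℕ) : rankSum (Fin m) m (X - 1 : ℤ[X]) = eulerianPoly m := by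
  rw [rankSum_fin, sub_add_cancel, eulerianPoly_eq_sum]

end Eulerian

section Convexity

variable {𝕜 E : Type*} [Field 𝕜] [LinearOrder 𝕜] [IsStrictOrderedRing 𝕜] [AddCommGroup E]
  [Module 𝕜 E] {S : Set E} {l : E →ₗ[𝕜] 𝕜} {M : 𝕜}

theorem mem_convexHull_of_apply_eq (hM : ∀ s ∈ S, l s ≤ M) {x : E} (hx : x ∈ convexHull 𝕜 S)
    (hlx : l x = M) : x ∈ convexHull 𝕜 {s ∈ S | l s = M} := by
  suffices h : convexHull 𝕜 S ⊆ {y | l y ≤ M ∧ (l y = M → y ∈ convexHull 𝕜 {s ∈ S | l s = M})} from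
    (h hx).2 hlx
  refine convexHull_min (fun s hs => ⟨hM s hs, fun h => subset_convexHull 𝕜 _ ⟨hs, h⟩⟩) ?_
  rw [convex_iff_forall_pos]
  rintro y ⟨hy, hy'⟩ z ⟨hz, hz'⟩ a b ha hb hab
  have hM' : a * M + b * M = M := by rw [← add_mul, hab, one_mul]
  have hay := mul_le_mul_of_nonneg_left hy ha.le
  have hbz := mul_le_mul_of_nonneg_left hz hb.le
  rw [Set.mem_ofPred_eq, map_add, map_smul, map_smul, smul_eq_mul, smul_eq_mul]
  refine ⟨(add_le_add hay hbz).trans_eq hM', fun h => ?_⟩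
  obtain ⟨hy_eq, hz_eq⟩ := (add_eq_add_iff_eq_and_eq hay hbz).1 (h.trans hM'.symm)
  exact convex_convexHull 𝕜 _ (hy' (mul_left_cancel₀ ha.ne' hy_eq))
    (hz' (mul_left_cancel₀ hb.ne' hz_eq)) ha.le hb.le hab

theorem setOf_isMaxOn_convexHull (hM : ∀ s ∈ S, l s ≤ M) (hex : ∃ s ∈ S, l s = M) :
    {x ∈ convexHull 𝕜 S | ∀ y ∈ convexHull 𝕜 S, l y ≤ l x} = convexHull 𝕜 {s ∈ S | l s = M} := by
  have hle : convexHull 𝕜 S ⊆ {x | l x ≤ M} :=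
    convexHull_min hM (convex_halfSpace_le l.isLinear M)
  have heq : convexHull 𝕜 {s ∈ S | l s = M} ⊆ {x | l x = M} :=
    convexHull_min (fun s hs => hs.2) (convex_hyperplane l.isLinear M)
  obtain ⟨s, hs, rfl⟩ := hex
  ext x
  constructor
  · rintro ⟨hx, hmax⟩
    exact mem_convexHull_of_apply_eq hM hx
      ((hle hx).antisymm (hmax s (subset_convexHull 𝕜 _ hs)))
  · intro hx
    exact ⟨convexHull_mono (Set.sep_subset _ _) hx, fun y hy => (hle hy).trans_eq (heq hx).symm⟩

end Convexity

section FiberSum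

variable {V κ : Type*} [Fintype V] [DecidableEq κ] {𝕜 : Type*} [Field 𝕜]

variable (𝕜) in
/-- The linear map that sends a vector to the sums of its coordinates over the nonempty fibers of
`π`. Its kernel is the direction space of a product of simplices, one for each fiber. -/
def fiberSum (π : V → κ) : (V → 𝕜) →ₗ[𝕜] (image π univ → 𝕜) :=
  LinearMap.pi fun p => ∑ j with π j = p, LinearMap.proj j

theorem mem_ker_fiberSum {π : V → κ} {v : V → 𝕜} :
    v ∈ LinearMap.ker (fiberSum 𝕜 π) ↔ ∀ p, ∑ j with π j = p, v j = 0 := by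
  simp only [LinearMap.mem_ker, funext_iff, fiberSum, LinearMap.pi_apply, LinearMap.sum_apply,
    LinearMap.proj_apply, Pi.zero_apply]
  refine ⟨fun h p => ?_, fun h p => h p⟩
  by_cases hp : p ∈ image π univ
  · exact h ⟨p, hp⟩
  · rw [filter_false_of_mem, sum_empty]
    rintro j - rfl
    exact hp (mem_image_of_mem π (mem_univ j))

theorem fiberSum_single [DecidableEq V] (π : V → κ) (j : V) (a : 𝕜) :
    fiberSum 𝕜 π (Pi.single j a) = Pi.single ⟨π j, mem_image_of_mem π (mem_univ j)⟩ a := by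
  ext p
  simp only [fiberSum, LinearMap.pi_apply, LinearMap.sum_apply, LinearMap.proj_apply,
    Pi.single_apply, sum_ite_eq', mem_filter_univ, Subtype.ext_iff, eq_comm (a := π j)]

theorem fiberSum_surjective (π : V → κ) : Function.Surjective (fiberSum 𝕜 π) := by
  classical
  rw [← LinearMap.range_eq_top, eq_top_iff]
  rintro g -
  rw [← univ_sum_single g]
  refine Submodule.sum_mem _ fun ⟨p, hp⟩ _ => ?_
  obtain ⟨j, -, rfl⟩ := mem_image.1 hp
  exact ⟨_, fiberSum_single π j _⟩

theorem finrank_ker_fiberSum (π : V → κ) (s : Finset κ) (hs : ∀ p ∉ s, #{j | π j = p} ≤ 1) :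
    Module.finrank 𝕜 (LinearMap.ker (fiberSum 𝕜 π)) = ∑ p ∈ s, (#{j | π j = p} - 1) := by
  have hrank := LinearMap.finrank_range_add_finrank_ker (fiberSum 𝕜 π)
  rw [LinearMap.range_eq_top.2 (fiberSum_surjective π), finrank_top,
    Module.finrank_fintype_fun_eq_card, Module.finrank_fintype_fun_eq_card,
    Fintype.card_coe] at hrank
  have hpos : ∀ p ∈ image π univ, 1 ≤ #{j | π j = p} := fun p hp =>
    (fiber_card_ne_zero_iff_mem_image univ π p).2 hp |> Nat.one_le_iff_ne_zero.2
  have himage : ∑ p ∈ image π univ, (#{j | π j = p} - 1) = Fintype.card V - #(image π univ) := by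
    rw [sum_tsub_distrib _ hpos, ← card_eq_sum_card_image, ← card_eq_sum_ones, card_univ]
  have hs' : ∑ p ∈ s ∪ image π univ, (#{j | π j = p} - 1) = ∑ p ∈ s, (#{j | π j = p} - 1) :=
    (sum_subset subset_union_left fun p _ hp => Nat.sub_eq_zero_of_le (hs p hp)).symm
  rw [← hs', ← sum_subset subset_union_right, himage]
  · omega
  · intro p _ hp
    rw [← fiber_card_ne_zero_iff_mem_image, not_not] at hp
    rw [hp, Nat.zero_sub]

theorem ker_fiberSum_le [DecidableEq V] {π : V → κ} {K : Submodule 𝕜 (V → 𝕜)}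
    (h : ∀ u w, u ≠ w → π u = π w → Pi.single u 1 - Pi.single w 1 ∈ K) :
    LinearMap.ker (fiberSum 𝕜 π) ≤ K := by
  have hsec (p : image π univ) : ∃ j, π j = p := by
    simpa only [mem_image, mem_univ, true_and] using p.2
  choose r hr using hsec
  let Q := Fintype.linearCombination 𝕜 fun p => K.mkQ (Pi.single (r p) 1)
  have hfactor : K.mkQ = Q ∘ₗ fiberSum 𝕜 π := by
    refine LinearMap.pi_ext' fun j => LinearMap.ext_ring ?_
    set p : image π univ := ⟨π j, mem_image_of_mem π (mem_univ j)⟩ with hp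
    have hclass : K.mkQ (Pi.single j 1) = K.mkQ (Pi.single (r p) 1) := by
      by_cases hj : j = r p
      · rw [← hj]
      · exact (Submodule.Quotient.eq K).2 (h _ _ hj (hr p).symm)
    simpa [Q, fiberSum_single, ← hp, Fintype.linearCombination_apply_single] using hclass
  calc LinearMap.ker (fiberSum 𝕜 π) ≤ LinearMap.ker (Q ∘ₗ fiberSum 𝕜 π) :=
        LinearMap.ker_le_ker_comp _ _
    _ = K := by rw [← hfactor, Submodule.ker_mkQ]

end FiberSum

section Faces

variable {N m : ℕ} {ρ : Fin N → ℕ} {σ τ : Equiv.Perm (Fin N)}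

theorem exists_perm_card_le {α : Type*} [LinearOrder α] (f : Fin N → α) :
    ∃ σ : Equiv.Perm (Fin N), ∀ j, #{u | f u < f j} ≤ σ j ∧ σ j < #{u | f u ≤ f j} := by
  have hmono := Tuple.monotone_sort f
  refine ⟨(Tuple.sort f).symm, fun j => ⟨?_, ?_⟩⟩
  · rw [← card_filter_comp (Tuple.sort f).toEmbedding (f · < f j) fun v _ =>
      (Tuple.sort f).surjective v, ← not_lt]
    exact (Tuple.lt_card_lt_iff_apply_lt_of_monotone hmono).not.2 (by simp)
  · rw [← card_filter_comp (Tuple.sort f).toEmbedding (f · ≤ f j) fun v _ =>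
      (Tuple.sort f).surjective v]
    exact (Tuple.lt_card_le_iff_apply_le_of_monotone hmono).2 (by simp)

theorem exists_perm_le_of_mem_rankings (hρ : ρ ∈ rankings (Fin N) m) :
    ∃ σ : Equiv.Perm (Fin N), ∀ j, ρ j ≤ σ j := by
  obtain ⟨σ, hσ⟩ := exists_perm_card_le ρ
  refine ⟨σ, fun j => ?_⟩
  rw [← mem_rankings_iff_forall.1 hρ j]
  exact (min_le_right _ _).trans (hσ j).1

theorem exists_perm_of_mem_rankings (hρ : ρ ∈ rankings (Fin N) m) (j : Fin N) :
    ∃ σ : Equiv.Perm (Fin N), (∀ i, ρ i ≤ σ i) ∧ min m (σ j) = ρ j := by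
  -- This preorder refines `ρ` by moving `j` to the front of its part.
  obtain ⟨σ, hσ⟩ := exists_perm_card_le fun u => 2 * ρ u + if u = j then 0 else 1
  have hrank := mem_rankings_iff_forall.1 hρ
  have hle (i : Fin N) : ρ i ≤ σ i := by
    refine ((hrank i).ge.trans (min_le_right _ _)).trans ((card_le_card ?_).trans (hσ i).1)
    exact monotone_filter_right _ fun u _ hu => by split_ifs <;> omega
  refine ⟨σ, hle, le_antisymm ?_ (le_min (le_of_mem_rankings hρ j) (hle j))⟩
  have hfront : ({u | 2 * ρ u + (if u = j then 0 else 1) ≤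
      2 * ρ j + if j = j then 0 else 1} : Finset (Fin N)) ⊆
      insert j ({u | ρ u < ρ j} : Finset (Fin N)) := by
    intro u hu
    simp only [mem_filter, mem_univ, true_and, mem_insert, if_true] at hu ⊢
    split_ifs at hu with huj
    · exact Or.inl huj
    · exact Or.inr (by omega)
  have hcard := (card_le_card hfront).trans (card_insert_le _ _)
  rw [← hrank j]
  exact min_le_min_left m (Nat.lt_succ_iff.1 ((hσ j).2.trans_le hcard))

variable {𝕜 : Type*} {lam : Fin N → 𝕜}

section LinearOrder

variable [LinearOrder 𝕜]

/-- The weight `lam` decreases strictly on `0, …, m` and is constant from `m` on. For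
`N = n + 1` and `m = n - k` these are the dominant weights of type `J(k, n)`. -/
def IsTruncated (m : ℕ) (lam : Fin N → 𝕜) : Prop :=
  ∀ i j : Fin N, lam i ≤ lam j ↔ min m (j : ℕ) ≤ min m (i : ℕ)

theorem IsTruncated.antivary_comp_iff (hlam : IsTruncated m lam) {α : Type*} [LinearOrder α]
    (c : Fin N → α) (σ : Equiv.Perm (Fin N)) :
    Antivary c (lam ∘ σ) ↔ ∀ j, truncRank m c j ≤ σ j := by
  constructor
  · intro h j
    by_contra! hlt
    obtain ⟨hm, hcard⟩ := lt_min_iff.1 hlt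
    rw [← card_filter_perm_lt σ (σ j).2.le] at hcard
    refine hcard.not_ge (card_le_card (monotone_filter_right _ fun u _ hu => ?_))
    have hle := (hlam _ _).1 (not_lt.1 fun hlt => (h hlt).not_gt hu)
    have hne : (σ u : ℕ) ≠ σ j := fun heq =>
      hu.ne (congrArg c (σ.injective (Fin.ext heq)))
    omega
  · intro h u j huj
    by_contra! hlt
    have hmin := not_le.1 ((hlam _ _).not.1 huj.not_ge)
    have hj : #{w | c w < c j} ≤ σ j := (min_le_iff.1 (h j)).resolve_left (by omega)
    have := (lt_iff_perm_lt_card h (by omega) u).1 hlt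
    omega

end LinearOrder

variable [Field 𝕜] [LinearOrder 𝕜]

/-- The face of the orbit polytope of `lam` that the ranking `ρ` encodes. -/
def rankFace (lam : Fin N → 𝕜) (ρ : Fin N → ℕ) : Set (Fin N → 𝕜) :=
  convexHull 𝕜 ((fun σ : Equiv.Perm (Fin N) => lam ∘ σ) '' {σ | ∀ j, ρ j ≤ σ j})

theorem comp_mem_rankFace (h : ∀ j, ρ j ≤ σ j) : lam ∘ σ ∈ rankFace lam ρ :=
  subset_convexHull 𝕜 _ ⟨σ, h, rfl⟩

theorem rankFace_nonempty (hρ : ρ ∈ rankings (Fin N) m) : (rankFace lam ρ).Nonempty := by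
  obtain ⟨σ, hσ⟩ := exists_perm_le_of_mem_rankings hρ
  exact ⟨_, comp_mem_rankFace hσ⟩

theorem orbitPolytope_eq_rankFace {n : ℕ} (lam : Fin (n + 1) → 𝕜) :
    orbitPolytope lam = rankFace lam 0 := by
  have hinv := (Equiv.inv (Equiv.Perm (Fin (n + 1)))).surjective.range_comp fun σ => lam ∘ σ
  have hrange : (Set.range fun w => weylAct w lam) = Set.range fun σ : Equiv.Perm (Fin (n + 1)) =>
      lam ∘ σ := hinv
  simp [rankFace, orbitPolytope, hrange]

variable [IsStrictOrderedRing 𝕜]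

theorem IsTruncated.sum_mul_comp_le (hlam : IsTruncated m lam) {c : Fin N → 𝕜}
    (hσ : ∀ j, truncRank m c j ≤ σ j) (τ : Equiv.Perm (Fin N)) :
    ∑ j, c j * lam (σ j) ≤ ∑ j, c j * lam (τ j) := by
  simpa using ((hlam.antivary_comp_iff c σ).2 hσ).sum_mul_le_sum_mul_comp_perm
    (σ := τ.trans σ.symm)

theorem IsTruncated.sum_mul_comp_eq_iff (hlam : IsTruncated m lam) {c : Fin N → 𝕜}
    (hσ : ∀ j, truncRank m c j ≤ σ j) (τ : Equiv.Perm (Fin N)) :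
    ∑ j, c j * lam (τ j) = ∑ j, c j * lam (σ j) ↔ ∀ j, truncRank m c j ≤ τ j := by
  have h := ((hlam.antivary_comp_iff c σ).2 hσ).sum_mul_eq_sum_mul_comp_perm_iff
    (σ := τ.trans σ.symm)
  have hτ : (lam ∘ σ) ∘ (τ.trans σ.symm) = lam ∘ τ := funext fun j => by simp
  rw [hτ, hlam.antivary_comp_iff c τ] at h
  simpa using h

theorem IsTruncated.setOf_isMaxOn_eq_rankFace (hlam : IsTruncated m lam)
    (l : (Fin N → 𝕜) →ₗ[𝕜] 𝕜) :
    {x ∈ rankFace lam 0 | ∀ y ∈ rankFace lam 0, l y ≤ l x} =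
      rankFace lam (truncRank m fun j => -l (Pi.single j 1)) := by
  set c : Fin N → 𝕜 := fun j => -l (Pi.single j 1) with hc
  have hl (τ : Equiv.Perm (Fin N)) : l (lam ∘ τ) = -∑ j, c j * lam (τ j) := by
    conv_lhs => rw [pi_eq_sum_univ' (lam ∘ τ)]
    simp [hc, mul_comm]
  obtain ⟨σ, hσ⟩ := exists_perm_card_le c
  have hσ' (j : Fin N) : truncRank m c j ≤ σ j := (min_le_right _ _).trans (hσ j).1
  rw [rankFace, setOf_isMaxOn_convexHull (M := l (lam ∘ σ)), rankFace]
  · congr 1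
    ext x
    constructor
    · rintro ⟨⟨τ, -, rfl⟩, h⟩
      rw [hl, hl, neg_inj] at h
      exact ⟨τ, (hlam.sum_mul_comp_eq_iff hσ' τ).1 h, rfl⟩
    · rintro ⟨τ, hτ, rfl⟩
      refine ⟨⟨τ, fun j => Nat.zero_le _, rfl⟩, ?_⟩
      rw [hl, hl, neg_inj]
      exact (hlam.sum_mul_comp_eq_iff hσ' τ).2 hτ
  · rintro _ ⟨τ, -, rfl⟩
    rw [hl, hl, neg_le_neg_iff]
    exact hlam.sum_mul_comp_le hσ' τ
  · exact ⟨_, ⟨σ, fun j => Nat.zero_le _, rfl⟩, rfl⟩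

theorem IsTruncated.isFace_rankFace_zero_iff (hlam : IsTruncated m lam)
    {F : Set (Fin N → 𝕜)} :
    IsFace 𝕜 (rankFace lam 0) F ↔ ∃ ρ ∈ rankings (Fin N) m, rankFace lam ρ = F := by
  constructor
  · rintro ⟨-, l, rfl⟩
    exact ⟨_, truncRank_mem_rankings m _, (hlam.setOf_isMaxOn_eq_rankFace l).symm⟩
  · rintro ⟨ρ, hρ, rfl⟩
    refine ⟨rankFace_nonempty hρ, -∑ j, (ρ j : 𝕜) • LinearMap.proj j, ?_⟩
    rw [hlam.setOf_isMaxOn_eq_rankFace]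
    congr 1
    conv_lhs => rw [← mem_rankings.1 hρ]
    funext j
    simp [truncRank, Pi.single_apply]

theorem IsTruncated.apply_le_of_mem_rankFace (hlam : IsTruncated m lam) {x : Fin N → 𝕜}
    (hx : x ∈ rankFace lam ρ) {j p : Fin N} (hp : min m (p : ℕ) ≤ ρ j) : x j ≤ lam p := by
  refine convexHull_min (t := {x | x j ≤ lam p}) ?_
    (convex_halfSpace_le (LinearMap.proj j).isLinear _) hx
  rintro _ ⟨σ, hσ, rfl⟩
  have := hσ j
  exact (hlam _ _).2 (by omega)

theorem IsTruncated.comp_mem_rankFace_iff (hlam : IsTruncated m lam) (hρ : ρ ∈ rankings (Fin N) m) :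
    lam ∘ τ ∈ rankFace lam ρ ↔ ∀ j, ρ j ≤ τ j := by
  refine ⟨fun h j => ?_, comp_mem_rankFace⟩
  obtain ⟨σ, -, hj⟩ := exists_perm_of_mem_rankings hρ j
  have := (hlam _ _).1 (hlam.apply_le_of_mem_rankFace h hj.le)
  omega

theorem IsTruncated.le_of_rankFace_subset (hlam : IsTruncated m lam) {ρ' : Fin N → ℕ}
    (hρ : ρ ∈ rankings (Fin N) m) (hρ' : ρ' ∈ rankings (Fin N) m)
    (h : rankFace lam ρ' ⊆ rankFace lam ρ) (j : Fin N) : ρ j ≤ ρ' j := by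
  obtain ⟨σ, hσ, hj⟩ := exists_perm_of_mem_rankings hρ' j
  rw [← hj]
  exact le_min (le_of_mem_rankings hρ j)
    ((hlam.comp_mem_rankFace_iff hρ).1 (h (comp_mem_rankFace hσ)) j)

theorem IsTruncated.injOn_rankFace (hlam : IsTruncated m lam) :
    Set.InjOn (rankFace lam) (rankings (Fin N) m : Set (Fin N → ℕ)) :=
  fun _ hρ _ hρ' h => le_antisymm (hlam.le_of_rankFace_subset hρ hρ' h.ge)
    (hlam.le_of_rankFace_subset hρ' hρ h.le)

theorem IsTruncated.ncard_isFace_and (hlam : IsTruncated m lam)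
    {q : (Fin N → ℕ) → Prop} [DecidablePred q] {Q : Set (Fin N → 𝕜) → Prop}
    (h : ∀ ρ ∈ rankings (Fin N) m, Q (rankFace lam ρ) ↔ q ρ) :
    {F | IsFace 𝕜 (rankFace lam 0) F ∧ Q F}.ncard = #{ρ ∈ rankings (Fin N) m | q ρ} := by
  have himage : {F | IsFace 𝕜 (rankFace lam 0) F ∧ Q F} =
      rankFace lam '' ({ρ ∈ rankings (Fin N) m | q ρ} : Finset (Fin N → ℕ)) := by
    ext F
    simp only [hlam.isFace_rankFace_zero_iff, coe_filter, Set.mem_image, Set.mem_ofPred_eq]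
    constructor
    · rintro ⟨⟨ρ, hρ, rfl⟩, hQ⟩
      exact ⟨ρ, ⟨hρ, (h ρ hρ).1 hQ⟩, rfl⟩
    · rintro ⟨ρ, ⟨hρ, hq⟩, rfl⟩
      exact ⟨⟨ρ, hρ, rfl⟩, (h ρ hρ).2 hq⟩
  rw [himage, (hlam.injOn_rankFace.mono fun ρ hρ => (mem_filter.1 hρ).1).ncard_image,
    Set.ncard_coe_finset]

end Faces

section Dimension

variable {N m : ℕ} {ρ : Fin N → ℕ} {σ τ : Equiv.Perm (Fin N)}

/-- The index of the block that contains `j` in the decomposition of `Fin N` into the parts of `ρ`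
that start at a position `< m` and singletons. -/
def blockIndex (m : ℕ) (ρ : Fin N → ℕ) (j : Fin N) : ℕ :=
  if ρ j < m then ρ j else m + j

theorem blockIndex_eq_iff {p : ℕ} (hp : p < m) {j : Fin N} : blockIndex m ρ j = p ↔ ρ j = p := by
  unfold blockIndex
  split_ifs <;> omega

theorem card_filter_blockIndex_le_one {p : ℕ} (hp : m ≤ p) : #{j | blockIndex m ρ j = p} ≤ 1 := by
  refine card_le_one.2 fun u hu w hw => ?_
  have hu := (mem_filter.1 hu).2
  have hw := (mem_filter.1 hw).2
  unfold blockIndex at hu hw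
  split_ifs at hu hw <;> omega

theorem lt_and_eq_of_blockIndex_eq {u w : Fin N} (huw : u ≠ w)
    (h : blockIndex m ρ u = blockIndex m ρ w) : ρ u < m ∧ ρ u = ρ w := by
  unfold blockIndex at h
  split_ifs at h <;> omega

theorem finrank_ker_fiberSum_blockIndex (𝕜 : Type*) [Field 𝕜] (m : ℕ) (ρ : Fin N → ℕ) :
    Module.finrank 𝕜 (LinearMap.ker (fiberSum 𝕜 (blockIndex m ρ))) = rankDim m ρ := by
  rw [finrank_ker_fiberSum _ (range m) fun p hp =>
    card_filter_blockIndex_le_one (not_lt.1 (mem_range.not.1 hp)), rankDim]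
  refine sum_congr rfl fun p hp => ?_
  simp only [blockIndex_eq_iff (mem_range.1 hp)]

theorem sub_comp_swap {V R : Type*} [DecidableEq V] [Ring R] (x : V → R) (u w : V) :
    x - x ∘ Equiv.swap u w = (x u - x w) • (Pi.single u 1 - Pi.single w 1) := by
  funext j
  rcases eq_or_ne j u with rfl | hu
  · rcases eq_or_ne j w with rfl | hw <;> simp [*]
  · rcases eq_or_ne j w with rfl | hw <;> simp [Equiv.swap_apply_of_ne_of_ne, *]

variable {𝕜 : Type*} [Field 𝕜] [LinearOrder 𝕜] {lam : Fin N → 𝕜}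

theorem IsTruncated.single_sub_single_mem_vectorSpan (hlam : IsTruncated m lam)
    (hρ : ρ ∈ rankings (Fin N) m) {u w : Fin N} (huw : u ≠ w) (hu : ρ u < m) (heq : ρ u = ρ w) :
    (Pi.single u 1 - Pi.single w 1 : Fin N → 𝕜) ∈ vectorSpan 𝕜 (rankFace lam ρ) := by
  obtain ⟨σ, hσ, hσu⟩ := exists_perm_of_mem_rankings hρ u
  have hswap (j : Fin N) : ρ j ≤ σ (Equiv.swap u w j) := by
    have hρj : ρ (Equiv.swap u w j) = ρ j := by
      rw [Equiv.swap_apply_def]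
      split_ifs <;> simp only [*]
    exact hρj ▸ hσ _
  have hne : lam (σ u) - lam (σ w) ≠ 0 := by
    intro h
    have hw := hσ w
    have hval : (σ u : ℕ) ≠ σ w := fun h => huw (σ.injective (Fin.ext h))
    have hle := (hlam _ _).1 (sub_eq_zero.1 h).le
    omega
  have hmem := vsub_mem_vectorSpan 𝕜 (comp_mem_rankFace (lam := lam) hσ)
    (comp_mem_rankFace (lam := lam) (σ := (Equiv.swap u w).trans σ) hswap)
  rw [Equiv.coe_trans, ← Function.comp_assoc, vsub_eq_sub, sub_comp_swap] at hmem
  exact (Submodule.smul_mem_iff _ hne).1 hmem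

variable [IsStrictOrderedRing 𝕜]

theorem IsTruncated.sum_monotone_mul_comp_eq (hlam : IsTruncated m lam)
    (hρ : ρ ∈ rankings (Fin N) m) (hσ : ∀ j, ρ j ≤ σ j) (hτ : ∀ j, ρ j ≤ τ j) {f : ℕ → 𝕜}
    (hf : Monotone f) : ∑ j, f (ρ j) * lam (σ j) = ∑ j, f (ρ j) * lam (τ j) := by
  have hle (j : Fin N) : truncRank m (f ∘ ρ) j ≤ ρ j :=
    (min_le_min_left _ (card_le_card (monotone_filter_right _ fun u _ hu =>
      hf.reflect_lt hu))).trans_eq (mem_rankings_iff_forall.1 hρ j)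
  exact (hlam.sum_mul_comp_eq_iff (fun j => (hle j).trans (hτ j)) σ).2
    fun j => (hle j).trans (hσ j)

theorem IsTruncated.sum_filter_apply_eq (hlam : IsTruncated m lam)
    (hρ : ρ ∈ rankings (Fin N) m) (hσ : ∀ j, ρ j ≤ σ j) (hτ : ∀ j, ρ j ≤ τ j) (p : ℕ) :
    ∑ j with ρ j = p, lam (σ j) = ∑ j with ρ j = p, lam (τ j) := by
  -- The indicator function of `p` is a difference of two monotone functions.
  let f (r q : ℕ) : 𝕜 := if r ≤ q then 1 else 0
  have hf (r : ℕ) : Monotone (f r) := fun a b hab => by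
    by_cases ha : r ≤ a
    · simp [f, ha, ha.trans hab]
    · simp only [f, if_neg ha]
      split_ifs <;> simp
  have hdiff (x : Fin N → 𝕜) :
      ∑ j with ρ j = p, x j = ∑ j, f p (ρ j) * x j - ∑ j, f (p + 1) (ρ j) * x j := by
    rw [sum_filter, ← sum_sub_distrib]
    refine sum_congr rfl fun j _ => ?_
    rcases lt_trichotomy (ρ j) p with h | h | h
    · simp [f, h.ne, h.not_ge, (h.trans p.lt_succ_self).not_ge]
    · simp [f, h]
    · simp [f, h.ne', h.le, Nat.succ_le_of_lt h]
  rw [hdiff, hdiff, hlam.sum_monotone_mul_comp_eq hρ hσ hτ (hf p),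
    hlam.sum_monotone_mul_comp_eq hρ hσ hτ (hf (p + 1))]

theorem IsTruncated.vectorSpan_rankFace_le (hlam : IsTruncated m lam)
    (hρ : ρ ∈ rankings (Fin N) m) :
    vectorSpan 𝕜 (rankFace lam ρ) ≤ LinearMap.ker (fiberSum 𝕜 (blockIndex m ρ)) := by
  rw [rankFace, ← direction_affineSpan, affineSpan_convexHull, direction_affineSpan,
    vectorSpan_def, Submodule.span_le]
  rintro _ ⟨_, ⟨σ, hσ, rfl⟩, _, ⟨τ, hτ, rfl⟩, rfl⟩
  refine mem_ker_fiberSum.2 fun p => ?_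
  simp only [vsub_eq_sub, Pi.sub_apply, Function.comp, sum_sub_distrib, sub_eq_zero]
  rcases lt_or_ge p m with hp | hp
  · simp only [blockIndex_eq_iff hp]
    exact hlam.sum_filter_apply_eq hρ hσ hτ p
  · refine sum_congr rfl fun j hj => ?_
    have hm : m ≤ ρ j := by
      have := (mem_filter.1 hj).2
      unfold blockIndex at this
      split_ifs at this <;> omega
    have := hσ j
    have := hτ j
    exact le_antisymm ((hlam _ _).2 (by omega)) ((hlam _ _).2 (by omega))

theorem IsTruncated.dim_rankFace (hlam : IsTruncated m lam) (hρ : ρ ∈ rankings (Fin N) m) :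
    dim 𝕜 (rankFace lam ρ) = rankDim m ρ := by
  have hspan : vectorSpan 𝕜 (rankFace lam ρ) = LinearMap.ker (fiberSum 𝕜 (blockIndex m ρ)) := by
    refine (hlam.vectorSpan_rankFace_le hρ).antisymm (ker_fiberSum_le fun u w huw h => ?_)
    obtain ⟨hu, heq⟩ := lt_and_eq_of_blockIndex_eq huw h
    exact hlam.single_sub_single_mem_vectorSpan hρ huw hu heq
  rw [dim, hspan, finrank_ker_fiberSum_blockIndex]

theorem IsTruncated.hPoly_rankFace_zero (hlam : IsTruncated m lam) :
    hPoly 𝕜 (rankFace lam 0) = rankSum (Fin N) m (X - 1 : ℤ[X]) := by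
  have hmaps (ρ : Fin N → ℕ) (hρ : ρ ∈ rankings (Fin N) m) :
      rankDim m ρ ∈ range (dim 𝕜 (rankFace lam 0) + 1) := by
    rw [mem_range, Nat.lt_succ_iff, ← hlam.dim_rankFace hρ]
    refine Submodule.finrank_mono (vectorSpan_mono 𝕜 (convexHull_mono (Set.image_mono ?_)))
    exact fun σ _ j => Nat.zero_le _
  rw [rankSum, ← sum_fiberwise_of_maps_to hmaps, hPoly]
  refine sum_congr rfl fun i _ => ?_
  rw [sum_congr rfl fun ρ hρ => by rw [(mem_filter.1 hρ).2], sum_const, faceNumber,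
    hlam.ncard_isFace_and fun ρ hρ => by rw [hlam.dim_rankFace hρ]]
  simp

end Dimension

section TypeA

variable {N n m k : ℕ} {𝕜 : Type*}

theorem simpleReflection_injective (n : ℕ) : Function.Injective (simpleReflection n) := by
  intro i j h
  have hi := congrArg (fun s : Equiv.Perm (Fin (n + 1)) => (s i.castSucc : ℕ)) h
  simp only [simpleReflection, Equiv.swap_apply_left, Equiv.swap_apply_def] at hi
  split_ifs at hi with hcast hsucc
  · exact Fin.castSucc_injective n hcast
  · simp only [Fin.ext_iff, Fin.val_castSucc, Fin.val_succ] at hi hsucc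
    omega
  · exact absurd hi (by simp)

theorem simpleReflection_mem_terminalReflections_iff {i : Fin n} :
    simpleReflection n i ∈ terminalReflections k n ↔ n - k ≤ i := by
  constructor
  · rintro ⟨j, hj, hij⟩
    rw [simpleReflection_injective n hij]
    omega
  · exact fun hi => ⟨i, by omega, rfl⟩

theorem weylAct_simpleReflection_eq_iff {i : Fin n} {lam : Fin (n + 1) → 𝕜} :
    weylAct (simpleReflection n i) lam = lam ↔ lam i.castSucc = lam i.succ := by
  simp only [funext_iff, weylAct, simpleReflection, Equiv.swap_inv]
  constructor
  · intro h
    simpa only [Equiv.swap_apply_right] using h i.succ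
  · intro h j
    rw [Equiv.swap_apply_def]
    split_ifs <;> simp only [*]

variable [LinearOrder 𝕜]

theorem IsTruncated.isSimple_rankFace_zero [Field 𝕜] [IsStrictOrderedRing 𝕜]
    {lam : Fin N → 𝕜} (hlam : IsTruncated m lam) : IsSimple 𝕜 (rankFace lam 0) := by
  intro v hv
  obtain ⟨ρ, hρ, hF⟩ := hlam.isFace_rankFace_zero_iff.1 hv
  obtain ⟨τ, hτ⟩ := exists_perm_le_of_mem_rankings hρ
  obtain rfl : lam ∘ τ = v := Set.eq_of_mem_singleton (hF ▸ comp_mem_rankFace hτ)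
  rw [hlam.dim_rankFace (zero_mem_rankings m),
    rankDim_eq_card_lowered (zero_mem_rankings m) fun j => Nat.zero_le _,
    ← card_filter_le_and_rankDim_eq_one, hlam.ncard_isFace_and
      (q := fun ρ => rankDim m ρ = 1 ∧ ∀ j, ρ j ≤ τ j)
      fun ρ hρ => by rw [hlam.dim_rankFace hρ, hlam.comp_mem_rankFace_iff hρ]]
  -- Relabelling by `τ` moves the vertex `lam ∘ τ` to the vertex `lam`.
  refine card_equiv (τ.arrowCongr (.refl ℕ)) fun ρ => ?_
  change _ ↔ ρ ∘ τ.symm ∈ _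
  simp only [mem_filter, comp_equiv_mem_rankings_iff, rankDim_comp_equiv, and_comm,
    Function.comp_apply, τ.symm.forall_congr_left (p := fun j => ρ (τ.symm j) ≤ j),
    Equiv.symm_symm, Equiv.symm_apply_apply]

theorem isTruncated_of_antitone {lam : Fin (n + 1) → 𝕜} (hanti : Antitone lam)
    (hstep : ∀ i : Fin n, lam i.castSucc = lam i.succ ↔ m ≤ i) : IsTruncated m lam := by
  have hconst (j : Fin (n + 1)) : m ≤ j → lam j = lam (Fin.last n) := by
    induction j using Fin.reverseInduction with
    | last => exact fun _ => rfl
    | cast i ih => exact fun hi => ((hstep i).2 hi).trans (ih (Nat.le_succ_of_le hi))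
  have hlt {i j : Fin (n + 1)} (hij : i < j) (hi : (i : ℕ) < m) : lam j < lam i := by
    obtain ⟨i, rfl⟩ := Fin.exists_castSucc_eq.2 (Fin.ne_last_of_lt hij)
    exact (hanti (Fin.castSucc_lt_iff_succ_le.1 hij)).trans_lt
      ((hanti i.castSucc_le_succ).lt_of_ne fun h => hi.not_ge ((hstep i).1 h.symm))
  intro i j
  constructor
  · intro hij
    by_contra! hmin
    exact (hlt (Fin.lt_def.2 (by omega)) (by omega)).not_ge hij
  · intro hmin
    rcases le_or_gt j i with hji | hij
    · exact hanti hji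
    · have : (i : ℕ) < j := hij
      rw [hconst i (by omega), hconst j (by omega)]

theorem IsDominantOfType.isTruncated {lam : Fin (n + 1) → 𝕜}
    (h : IsDominantOfType (terminalReflections k n) lam) : IsTruncated (n - k) lam := by
  refine isTruncated_of_antitone h.1 fun i => ?_
  rw [← simpleReflection_mem_terminalReflections_iff, ← h.2, ← weylAct_simpleReflection_eq_iff]
  exact ⟨fun hi => ⟨⟨i, rfl⟩, hi⟩, fun hi => hi.2⟩

end TypeA

end OrbitPolytope

theorem theorem6 (𝕜 : Type*) [Field 𝕜] [LinearOrder 𝕜] [IsStrictOrderedRing 𝕜]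
    (n k : ℕ) (hk : 1 ≤ k) (hkn : k ≤ n) :
    OrbitPolytope.CombinatoriallySmooth 𝕜 (OrbitPolytope.terminalReflections k n) ∧
    ∀ lam mu : Fin (n + 1) → 𝕜,
      OrbitPolytope.IsDominantOfType (OrbitPolytope.terminalReflections k n) lam →
      OrbitPolytope.IsDominantOfType (OrbitPolytope.terminalReflections (k - 1) n) mu →
      OrbitPolytope.hPoly 𝕜 (OrbitPolytope.orbitPolytope lam) =
        OrbitPolytope.hPoly 𝕜 (OrbitPolytope.orbitPolytope mu) -
          C ((n + 1).choose (k + 1) : ℤ) * (∑ i ∈ Finset.Icc 1 k, X ^ i) *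
            OrbitPolytope.eulerianPoly (n - k) := by
  refine ⟨fun lam hlam => ?_, fun lam mu hlam hmu => ?_⟩
  · rw [OrbitPolytope.orbitPolytope_eq_rankFace]
    exact hlam.isTruncated.isSimple_rankFace_zero
  · have hrec := OrbitPolytope.rankSum_succ (V := Fin (n + 1)) (m := n - k)
      (by rw [Fintype.card_fin]; omega) (X - 1 : ℤ[X])
    have hchoose : (n + 1).choose (n - k) = (n + 1).choose (k + 1) := by
      rw [← Nat.choose_symm (by omega : k + 1 ≤ n + 1), Nat.add_sub_add_right]
    have hgeom : ∑ i ∈ Finset.range k, (X : ℤ[X]) ^ (i + 1) = ∑ i ∈ Finset.Icc 1 k, X ^ i := by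
      rw [Finset.range_eq_Ico, Finset.sum_Ico_add' (fun i => (X : ℤ[X]) ^ i), zero_add,
        Finset.Ico_add_one_right_eq_Icc]
    rw [sub_add_cancel, OrbitPolytope.rankSum_fin_sub_one, Fintype.card_fin, hchoose,
      (by omega : n + 1 - (n - k + 1) = k), hgeom] at hrec
    rw [OrbitPolytope.orbitPolytope_eq_rankFace, OrbitPolytope.orbitPolytope_eq_rankFace,
      hlam.isTruncated.hPoly_rankFace_zero, hmu.isTruncated.hPoly_rankFace_zero,
      (by omega : n - (k - 1) = n - k + 1), hrec, map_natCast, add_sub_cancel_right]
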